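/- Let $k \ge 2$ and $n \ge 1$. The $k$-ary de Bruijn graph $G_n^k$ of order $n$ is the directed graph (loops allowed) whose vertices are the words of length $n$ over an alphabet of $k$ letters, with an edge from $x$ to $y$ if and only if $x = at$ and $y = tb$ for some letters $a, b$ and some word $t$. A directed graph is called Eulerian if at each vertex the number of incoming edges equals the number of outgoing edges; it is called connected if it has a vertex and any two of its vertices are joined by a path in which edges may be traversed in either direction. A cycle of length $m \ge 1$ is a directed graph with $m$ distinct vertices $v_0, \dots, v_{m-1}$ whose edges are exactly $(v_0,v_1), (v_1,v_2), \dots, (v_{m-1},v_0)$ (a single vertex with a loop if $m = 1$). Theorem. Let $k \ge 2$ and $n \ge 1$. Then for every integer $N$ with $0 < N \le k^{n+1}$, the graph $G_n^k$ contains a connected Eulerian subgraph $H$ with exactly $N$ edges and exactly $\min\{k^n, N\}$ vertices. Moreover, $H$ is a cycle if $N \le k^n$, and $H$ contains all vertices of $G_n^k$ if $N > k^n$. -/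

import Mathlib

/-- The `k`-ary de Bruijn graph of order `n`: the vertices are the words of length `n` over the
alphabet `Fin k`, and there is an edge from `x` to `y` if `x = a t` and `y = t b` for some letters
`a`, `b` and a word `t`. Loops are allowed. -/
def deBruijnGraph (k n : ℕ) : Digraph (List.Vector (Fin k) n) where
  Adj x y := ∃ (a b : Fin k) (t : List (Fin k)), x.toList = a :: t ∧ y.toList = t ++ [b]

namespace Digraph

/-- A subgraph of a directed graph: a set of vertices, together with a set of edges of the graph
joining these vertices. -/
@[ext]
structure DiSubgraph {V : Type*} (G : Digraph V) where
  verts : Set V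
  Adj : V → V → Prop
  adj_sub : ∀ {x y : V}, Adj x y → G.Adj x y
  fst_mem : ∀ {x y : V}, Adj x y → x ∈ verts
  snd_mem : ∀ {x y : V}, Adj x y → y ∈ verts

namespace DiSubgraph

variable {V : Type*} {G : Digraph V}

/-- The set of (directed) edges; the edge from `x` to `y` is the ordered pair `(x, y)`. -/
def edges (H : G.DiSubgraph) : Set (V × V) := {e | H.Adj e.1 e.2}

/-- Connectedness: there is a vertex, and any two vertices are joined by a path in which edges may
be traversed in either direction. -/
def IsConnected (H : G.DiSubgraph) : Prop :=
  H.verts.Nonempty ∧ ∀ x ∈ H.verts, ∀ y ∈ H.verts,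
    Relation.ReflTransGen (fun u v => H.Adj u v ∨ H.Adj v u) x y

/-- Eulerian: at each vertex, the number of incoming edges is the number of outgoing edges.
The numbers are taken in `ℕ∞`. -/
def IsEulerian (H : G.DiSubgraph) : Prop :=
  ∀ v ∈ H.verts, {u | H.Adj u v}.encard = {u | H.Adj v u}.encard

/-- The subgraph is a cycle: its vertices are pairwise distinct `v 0, …, v (m - 1)`, with `1 ≤ m`,
and its edges are those from `v i` to `v (i + 1)`, with indices modulo `m`. -/
def IsCycle (H : G.DiSubgraph) : Prop :=
  ∃ m : ℕ, 0 < m ∧ ∃ v : ZMod m → V, Function.Injective v ∧ H.verts = Set.range v ∧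
    ∀ x y : V, H.Adj x y ↔ ∃ i : ZMod m, v i = x ∧ v (i + 1) = y

end DiSubgraph

end Digraph

/-! The engine is the line digraph structure: the edges of one de Bruijn graph are the vertices of
the next, so a closed trail of length `N` in order `n` is a cycle of length `N` in order `n + 1`
(`exists_cycle_of_isClosedTrail`). Cycles of all lengths (`exists_cycle`) follow by induction on the
order, once closed trails of lengths between `k ^ n` and `k ^ (n + 1)` are available.

For these, write `N = q * k ^ n + r` with `0 < r ≤ k ^ n` and take a cycle of length `r`. It extends
to a permutation of the vertices along edges, which belongs to a partition of all edges into `k`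
such permutations (`exists_perm_family`). The cycle and `q` of the other permutations form a
spanning, edge-disjoint family of closed trails. Exchanging successors merges them into one closed
trail of the same length (`exists_perm_sameCycle`); its edges may change, but its vertices remain
all of them. -/

/-! ### Cycles of permutations. -/

/-- Multiplying a permutation by the transposition of two points in different cycles merges
the two cycles. -/
theorem Equiv.Perm.SameCycle.mul_swap_of_not_sameCycle {J : Type*} [Finite J] [DecidableEq J]
    {τ : Equiv.Perm J} {a b : J} (hab : ¬ τ.SameCycle a b) :
    (τ * Equiv.swap a b).SameCycle a b ∧
      ∀ c, τ.SameCycle a c → (τ * Equiv.swap a b).SameCycle a c := by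
  set π := τ * Equiv.swap a b with hπ
  have hπa : π a = τ b := by simp [hπ]
  have hπb : π b = τ a := by simp [hπ]
  have hπc : ∀ c, c ≠ a → c ≠ b → π c = τ c := fun c h₁ h₂ => by
    simp [hπ, Equiv.swap_apply_of_ne_of_ne h₁ h₂]
  have step : ∀ c, π.SameCycle a c → π.SameCycle a (π c) := fun c hc =>
    Equiv.Perm.sameCycle_apply_right.2 hc
  -- From `a`, `π` jumps to `τ b` and follows the `τ`-cycle of `b` until it reaches `b`.
  have hb : ∀ i : ℕ, π.SameCycle a ((τ ^ i) (τ b)) := by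
    intro i
    induction i with
    | zero => simpa [← hπa] using step a (Equiv.Perm.SameCycle.refl _ _)
    | succ i ih =>
      rw [pow_succ', Equiv.Perm.mul_apply]
      by_cases h : (τ ^ i) (τ b) = b
      · rw [h, ← hπa]
        exact step a (Equiv.Perm.SameCycle.refl _ _)
      · rw [← hπc _ _ h]
        · exact step _ ih
        · intro h'
          refine hab (Equiv.Perm.SameCycle.symm ⟨(i + 1 : ℕ), ?_⟩)
          rw [zpow_natCast, pow_succ, Equiv.Perm.mul_apply, h']
  have hab' : π.SameCycle a b := by
    obtain ⟨i, hi⟩ := (Equiv.Perm.sameCycle_apply_left.2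
      (Equiv.Perm.SameCycle.refl τ b)).exists_nat_pow_eq
    exact hi ▸ hb i
  refine ⟨hab', fun c hc => ?_⟩
  have ha : ∀ i : ℕ, π.SameCycle a ((τ ^ i) a) := by
    intro i
    induction i with
    | zero => exact Equiv.Perm.SameCycle.refl _ _
    | succ i ih =>
      rw [pow_succ', Equiv.Perm.mul_apply]
      by_cases h : (τ ^ i) a = a
      · rw [h, ← hπb]
        exact step b hab'
      · rw [← hπc _ h]
        · exact step _ ih
        · intro h'
          exact hab ⟨i, by rw [zpow_natCast, h']⟩
  obtain ⟨i, hi⟩ := hc.exists_nat_pow_eq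
  exact hi ▸ ha i

/-- A permutation with a single cycle on a finite type is the successor map of a cyclic
enumeration. -/
theorem Equiv.Perm.exists_zmod_equiv_of_forall_sameCycle {J : Type*} [Finite J]
    {τ : Equiv.Perm J} {a : J} (h : ∀ c, τ.SameCycle a c) :
    ∃ w : ZMod (Nat.card J) ≃ J, ∀ i, w (i + 1) = τ (w i) := by
  obtain ⟨p, hp⟩ : ∃ p, p = Function.minimalPeriod τ a := ⟨_, rfl⟩
  have hper : a ∈ Function.periodicPts τ :=
    Function.Injective.mem_periodicPts τ.injective a
  have hp0 : 0 < p := hp ▸ Function.minimalPeriod_pos_of_mem_periodicPts hper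
  have : NeZero p := ⟨hp0.ne'⟩
  have hmod : ∀ n, τ^[n % p] a = τ^[n] a := fun n => by
    rw [hp, Function.iterate_mod_minimalPeriod_eq]
  have hinj : Function.Injective fun i : ZMod p => τ^[i.val] a := by
    intro i j hij
    refine ZMod.val_injective p (Function.iterate_injOn_Iio_minimalPeriod (f := τ) (x := a)
      ?_ ?_ hij)
    · exact hp ▸ ZMod.val_lt i
    · exact hp ▸ ZMod.val_lt j
  have hsurj : Function.Surjective fun i : ZMod p => τ^[i.val] a := by
    intro c
    obtain ⟨i, hi⟩ := (h c).exists_nat_pow_eq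
    refine ⟨(i : ZMod p), ?_⟩
    simp only [ZMod.val_natCast]
    rw [hmod, ← hi, Equiv.Perm.iterate_eq_pow]
  let w : ZMod p ≃ J := Equiv.ofBijective _ ⟨hinj, hsurj⟩
  have hw : ∀ i, w (i + 1) = τ (w i) := by
    intro i
    change τ^[(i + 1).val] a = τ (τ^[i.val] a)
    rw [← Function.iterate_succ_apply' τ, ZMod.val_add, ZMod.val_one_eq_one_mod, Nat.add_mod_mod, hmod]
  have hcard : Nat.card J = p := by rw [← Nat.card_congr w, Nat.card_zmod]
  rw [hcard]
  exact ⟨w, hw⟩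

/-! ### Merging closed trails in line digraphs. -/

namespace Digraph

variable {V : Type*}

/-- A closed trail of length `N`: a closed walk with pairwise distinct edges. -/
structure IsClosedTrail (G : Digraph V) {N : ℕ} (u : ZMod N → V) : Prop where
  adj : ∀ i, G.Adj (u i) (u (i + 1))
  inj : Function.Injective fun i => (u i, u (i + 1))

theorem exists_adj_of_reflTransGen {G : Digraph V} {S : Set V} {x y : V}
    (h : Relation.ReflTransGen G.Adj x y) (hx : x ∈ S) (hy : y ∉ S) :
    ∃ a ∈ S, ∃ b, b ∉ S ∧ G.Adj a b := by
  induction h with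
  | refl => exact absurd hx hy
  | @tail b c _ hbc ih =>
    by_cases hb : b ∈ S
    · exact ⟨b, hb, c, hy, hbc⟩
    · exact ih hb

/-- In a strongly connected line digraph, a spanning family of closed trails, given by a
permutation `τ` of the index set of their edges, can be turned into a single closed trail. -/
theorem exists_perm_sameCycle {G : Digraph V} {J : Type*} [Finite J]
    (hline : ∀ x y x' y', G.Adj x y → G.Adj x y' → G.Adj x' y → G.Adj x' y')
    (hconn : ∀ x y, Relation.ReflTransGen G.Adj x y)
    {s : J → V} (hs : Function.Surjective s) (a : J) {τ₀ : Equiv.Perm J}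
    (hadj : ∀ j, G.Adj (s j) (s (τ₀ j))) (hinj : Function.Injective fun j => (s j, s (τ₀ j))) :
    ∃ τ : Equiv.Perm J, (∀ j, G.Adj (s j) (s (τ j))) ∧
      (Function.Injective fun j => (s j, s (τ j))) ∧ ∀ j, τ.SameCycle a j := by
  classical
  let P : Set (Equiv.Perm J) := {τ | (∀ j, G.Adj (s j) (s (τ j))) ∧
    Function.Injective fun j => (s j, s (τ j))}
  obtain ⟨τ, hτ, hmax⟩ := Set.exists_max_image P (fun τ => {j | τ.SameCycle a j}.ncard)
    (Set.toFinite _) ⟨τ₀, hadj, hinj⟩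
  refine ⟨τ, hτ.1, hτ.2, ?_⟩
  by_contra! hne
  obtain ⟨j₀, hj₀⟩ := hne
  -- A merge that stays in `P` would enlarge the cycle of `a`, against maximality.
  have key : ∀ c d, τ.SameCycle a c → ¬ τ.SameCycle a d → τ * Equiv.swap c d ∉ P := by
    intro c d hc hd hP
    obtain ⟨h₁, h₂⟩ := Equiv.Perm.SameCycle.mul_swap_of_not_sameCycle
      (fun h : τ.SameCycle c d => hd (hc.trans h))
    have hac := (h₂ a hc.symm).symm
    refine (hmax _ hP).not_gt (Set.ncard_lt_ncard ?_ (Set.toFinite _))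
    exact (Set.ssubset_iff_of_subset fun j hj => hac.trans (h₂ j (hc.symm.trans hj))).2
      ⟨d, hac.trans h₁, hd⟩
  have apply_other : ∀ c d j, j ≠ c → j ≠ d → (τ * Equiv.swap c d) j = τ j := fun c d j h h' => by
    simp [Equiv.swap_apply_of_ne_of_ne h h']
  have hinv : ∀ j, τ.SameCycle a (τ⁻¹ j) ↔ τ.SameCycle a j := fun j =>
    Equiv.Perm.sameCycle_symm_apply_right
  have happ : ∀ j, τ.SameCycle a (τ j) ↔ τ.SameCycle a j := fun j =>
    Equiv.Perm.sameCycle_apply_right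
  by_cases hsh : ∃ c d, τ.SameCycle a c ∧ ¬ τ.SameCycle a d ∧ s c = s d
  · obtain ⟨c, d, hc, hd, hcd⟩ := hsh
    -- Two cycles through the same vertex: exchanging the successors `c` and `d` leaves `s ∘ τ`,
    -- hence every edge, unchanged.
    refine key (τ⁻¹ c) (τ⁻¹ d) ((hinv c).2 hc) (mt (hinv d).1 hd) ?_
    have heq : ∀ j, s ((τ * Equiv.swap (τ⁻¹ c) (τ⁻¹ d)) j) = s (τ j) := by
      intro j
      by_cases h : j = τ⁻¹ c
      · subst h; simp [hcd]
      by_cases h' : j = τ⁻¹ d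
      · subst h'; simp [hcd]
      rw [apply_other _ _ _ h h']
    refine ⟨fun j => heq j ▸ hτ.1 j, ?_⟩
    simpa only [heq] using hτ.2
  · push Not at hsh
    let S : Set V := s '' {j | τ.SameCycle a j}
    have hS : ∀ j, s j ∈ S ↔ τ.SameCycle a j := by
      refine fun j => ⟨?_, fun h => ⟨j, h, rfl⟩⟩
      rintro ⟨c, hc, hcj⟩
      by_contra h
      exact hsh c j hc h hcj
    -- No vertex is shared now, so an edge of `G` leaving `S` is used to exchange the heads of two
    -- trail edges; the line digraph property supplies the second new edge.
    obtain ⟨x, hx, y, hy, hxy⟩ := exists_adj_of_reflTransGen (hconn (s a) (s j₀))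
      ((hS a).2 (Equiv.Perm.SameCycle.refl _ _)) (mt (hS j₀).1 hj₀)
    obtain ⟨c, rfl⟩ := hs x
    obtain ⟨d', rfl⟩ := hs y
    obtain ⟨d, rfl⟩ := τ.surjective d'
    have hc := (hS c).1 hx
    have hd : ¬ τ.SameCycle a d := fun h => hy ((hS _).2 ((happ d).2 h))
    have hcd : c ≠ d := fun h => hd (h ▸ hc)
    refine key c d hc hd ?_
    set π := τ * Equiv.swap c d with hπ
    have hπc : π c = τ d := by simp [hπ]
    have hπd : π d = τ c := by simp [hπ]
    -- Only the two new edges cross between `S` and its complement, in opposite directions, so they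
    -- differ from each other and from all old edges.
    have hcross : ∀ j, (τ.SameCycle a j ↔ τ.SameCycle a (π j)) ↔ j ≠ c ∧ j ≠ d := by
      intro j
      by_cases h : j = c
      · subst h; simp [hπc, hc, happ, hd]
      by_cases h' : j = d
      · subst h'; simp [hπd, hc, happ, hd]
      simp [hπ, apply_other _ _ _ h h', happ, h, h']
    refine ⟨fun j => ?_, fun i j hij => ?_⟩
    · by_cases h : j = c
      · subst h; rwa [hπc]
      by_cases h' : j = d
      · subst h'; rw [hπd]; exact hline _ _ _ _ hxy (hτ.1 c) (hτ.1 j)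
      rw [apply_other _ _ _ h h']; exact hτ.1 j
    · simp only [Prod.mk.injEq] at hij
      obtain ⟨h₁, h₂⟩ := hij
      have e₁ : τ.SameCycle a i ↔ τ.SameCycle a j := by rw [← hS, ← hS, h₁]
      have e₂ : τ.SameCycle a (π i) ↔ τ.SameCycle a (π j) := by rw [← hS, ← hS, h₂]
      have e : (i ≠ c ∧ i ≠ d) ↔ (j ≠ c ∧ j ≠ d) := by rw [← hcross i, ← hcross j, e₁, e₂]
      by_cases hi : i ≠ c ∧ i ≠ d
      · rw [apply_other _ _ _ hi.1 hi.2, apply_other _ _ _ (e.1 hi).1 (e.1 hi).2] at h₂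
        exact hτ.2 (Prod.ext h₁ h₂)
      · have hj := mt e.2 hi
        rw [not_and_or, not_not, not_not] at hi hj
        rcases hi with rfl | rfl <;> rcases hj with rfl | rfl
        · rfl
        · exact absurd (e₁.1 hc) hd
        · exact absurd (e₁.2 hc) hd
        · rfl

/-- The permutation version of a closed trail, traversed cyclically. -/
theorem exists_isClosedTrail_surjective {G : Digraph V} {J : Type*} [Finite J] [Nonempty J]
    (hline : ∀ x y x' y', G.Adj x y → G.Adj x y' → G.Adj x' y → G.Adj x' y')
    (hconn : ∀ x y, Relation.ReflTransGen G.Adj x y)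
    {s : J → V} (hs : Function.Surjective s) {τ₀ : Equiv.Perm J}
    (hadj : ∀ j, G.Adj (s j) (s (τ₀ j))) (hinj : Function.Injective fun j => (s j, s (τ₀ j))) :
    ∃ u : ZMod (Nat.card J) → V, G.IsClosedTrail u ∧ Function.Surjective u := by
  obtain ⟨τ, h₁, h₂, h₃⟩ :=
    exists_perm_sameCycle hline hconn hs (Classical.arbitrary J) hadj hinj
  obtain ⟨w, hw⟩ := Equiv.Perm.exists_zmod_equiv_of_forall_sameCycle h₃
  refine ⟨s ∘ w, ⟨fun i => ?_, fun i j hij => ?_⟩, hs.comp w.surjective⟩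
  · simpa [hw] using h₁ (w i)
  · simp only [Function.comp_apply, hw] at hij
    exact w.injective (h₂ hij)

end Digraph

/-! ### Closed trails and cycles in de Bruijn graphs. -/

namespace deBruijnGraph

variable {k m : ℕ}

theorem adj_iff {x y : List.Vector (Fin k) (m + 1)} :
    (deBruijnGraph k (m + 1)).Adj x y ↔ ∃ a b t, x = a ::ᵥ t ∧ y = t.snoc b := by
  constructor
  · rintro ⟨a, b, t, hx, hy⟩
    have ht : t.length = m := by
      have := x.toList_length
      rw [hx] at this
      simpa using this
    exact ⟨a, b, ⟨t, ht⟩, Subtype.ext hx, Subtype.ext hy⟩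
  · rintro ⟨a, b, t, rfl, rfl⟩
    exact ⟨a, b, t.toList, rfl, rfl⟩

theorem snoc_injective2 : Function.Injective2
    (List.Vector.snoc : List.Vector (Fin k) m → Fin k → List.Vector (Fin k) (m + 1)) := by
  intro t t' b b' h
  have h' := congrArg List.Vector.toList h
  change t.toList ++ [b] = t'.toList ++ [b'] at h'
  rw [List.append_inj_left' h' rfl |> List.Vector.toList_injective]
  have := List.append_inj_right' h' rfl
  exact ⟨rfl, by simpa using this⟩

theorem cons_injective2 : Function.Injective2
    (List.Vector.cons : Fin k → List.Vector (Fin k) m → List.Vector (Fin k) (m + 1)) := by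
  intro a a' t t' h
  exact ⟨by simpa using congrArg List.Vector.head h, by simpa using congrArg List.Vector.tail h⟩

theorem adj_cons_iff {a : Fin k} {t : List.Vector (Fin k) m} {y : List.Vector (Fin k) (m + 1)} :
    (deBruijnGraph k (m + 1)).Adj (a ::ᵥ t) y ↔ ∃ b, y = t.snoc b := by
  rw [adj_iff]
  constructor
  · rintro ⟨a', b, t', h, rfl⟩
    exact ⟨b, by rw [(cons_injective2 h).2]⟩
  · rintro ⟨b, rfl⟩
    exact ⟨a, b, t, rfl, rfl⟩

theorem adj_snoc_iff {b : Fin k} {t : List.Vector (Fin k) m} {x : List.Vector (Fin k) (m + 1)} :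
    (deBruijnGraph k (m + 1)).Adj x (t.snoc b) ↔ ∃ a, x = a ::ᵥ t := by
  rw [adj_iff]
  constructor
  · rintro ⟨a, b', t', rfl, h⟩
    exact ⟨a, by rw [(snoc_injective2 h).1]⟩
  · rintro ⟨a, rfl⟩
    exact ⟨a, b, t, rfl, rfl⟩

/-- A common out-neighbour forces `x` and `x'` to share the word after their first letter, and this
word alone determines the out-neighbours. -/
theorem adj_of_adj_of_adj_of_adj (x y x' y' : List.Vector (Fin k) (m + 1))
    (h₁ : (deBruijnGraph k (m + 1)).Adj x y) (h₂ : (deBruijnGraph k (m + 1)).Adj x y')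
    (h₃ : (deBruijnGraph k (m + 1)).Adj x' y) : (deBruijnGraph k (m + 1)).Adj x' y' := by
  obtain ⟨a, b, t, rfl, rfl⟩ := adj_iff.1 h₁
  obtain ⟨b', rfl⟩ := adj_cons_iff.1 h₂
  obtain ⟨a', rfl⟩ := adj_snoc_iff.1 h₃
  exact adj_iff.2 ⟨_, _, _, rfl, rfl⟩

theorem reflTransGen_adj (x y : List.Vector (Fin k) (m + 1)) :
    Relation.ReflTransGen (deBruijnGraph k (m + 1)).Adj x y := by
  -- Append the letters of `w` one at a time and slide the window; `w = y` is used at the end.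
  have key : ∀ (w : List (Fin k)) (x : List.Vector (Fin k) (m + 1)),
      y.toList = (x.toList ++ w).drop w.length →
      Relation.ReflTransGen (deBruijnGraph k (m + 1)).Adj x y := by
    intro w
    induction w with
    | nil =>
      intro x h
      have hxy : y = x := List.Vector.toList_injective (by simpa using h)
      rw [hxy]
    | cons b w ih =>
      intro x h
      obtain ⟨a, t, rfl⟩ := List.Vector.exists_eq_cons x
      refine Relation.ReflTransGen.head (adj_cons_iff.2 ⟨b, rfl⟩) (ih (t.snoc b) ?_)
      change _ = ((t.toList ++ [b]) ++ w).drop w.length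
      simpa using h
  exact key y.toList x (by simp)

/-- Words of length `m + 1`, split into their first letter and the rest. -/
noncomputable def consEquiv (k m : ℕ) :
    List.Vector (Fin k) m × Fin k ≃ List.Vector (Fin k) (m + 1) :=
  Equiv.ofBijective (fun p => p.2 ::ᵥ p.1)
    ((Fintype.bijective_iff_injective_and_card _).2
      ⟨fun _ _ h => Prod.ext (cons_injective2 h).2 (cons_injective2 h).1, by simp [pow_succ]⟩)

/-- Words of length `m + 1`, split into their last letter and the rest. -/
noncomputable def snocEquiv (k m : ℕ) :
    List.Vector (Fin k) m × Fin k ≃ List.Vector (Fin k) (m + 1) :=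
  Equiv.ofBijective (fun p => p.1.snoc p.2)
    ((Fintype.bijective_iff_injective_and_card _).2
      ⟨fun _ _ h => Prod.ext (snoc_injective2 h).1 (snoc_injective2 h).2, by simp [pow_succ]⟩)

/-- The edges of the de Bruijn graph can be partitioned into `k` permutations of the vertices,
one of which extends a given cycle. -/
theorem exists_perm_family [NeZero k] {r : ℕ} {v : ZMod r → List.Vector (Fin k) (m + 1)}
    (hv : Function.Injective v) (hadj : ∀ i, (deBruijnGraph k (m + 1)).Adj (v i) (v (i + 1))) :
    ∃ Y : Fin k → Equiv.Perm (List.Vector (Fin k) (m + 1)),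
      (∀ c x, (deBruijnGraph k (m + 1)).Adj x (Y c x)) ∧
      (∀ x, Function.Injective fun c => Y c x) ∧ ∀ i, Y 0 (v i) = v (i + 1) := by
  classical
  -- At each middle word `t` the cycle defines a partial injection from first letters to appended
  -- letters; it extends to a permutation.
  have hσ : ∀ t : List.Vector (Fin k) m, ∃ σ : Equiv.Perm (Fin k),
      ∀ i a, v i = a ::ᵥ t → t.snoc (σ a) = v (i + 1) := by
    intro t
    let s : Set (Fin k) := {a | ∃ i, v i = a ::ᵥ t}
    have hs : ∀ a : Fin k, ∃ b, ∀ i, v i = a ::ᵥ t → t.snoc b = v (i + 1) := by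
      intro a
      by_cases h : ∃ i, v i = a ::ᵥ t
      · obtain ⟨i, hi⟩ := h
        obtain ⟨b, hb⟩ := adj_cons_iff.1 (hi ▸ hadj i)
        exact ⟨b, fun j hj => by rw [hv (hj.trans hi.symm), hb]⟩
      · exact ⟨0, fun i hi => absurd ⟨i, hi⟩ h⟩
    choose f hf using hs
    have hinj : Set.InjOn f s := by
      rintro a ⟨i, hi⟩ a' ⟨i', hi'⟩ h
      have h' : v (i + 1) = v (i' + 1) := by rw [← hf a i hi, ← hf a' i' hi', h]
      have h'' : i = i' := by simpa using hv h'
      subst h''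
      exact (cons_injective2 (hi.symm.trans hi')).1
    obtain ⟨g, hg⟩ := Set.MapsTo.exists_equiv_extend_of_card_eq (t := Finset.univ)
      (by simp) (fun a _ => by simp) hinj
    refine ⟨g.trans (Equiv.subtypeUnivEquiv fun _ => Finset.mem_univ _), fun i a hi => ?_⟩
    rw [← hf a i hi]
    exact congrArg _ (hg a ⟨i, hi⟩)
  choose σ hσ using hσ
  let Y : Fin k → Equiv.Perm (List.Vector (Fin k) (m + 1)) := fun c =>
    (consEquiv k m).symm.trans
      ((Equiv.prodShear (Equiv.refl _) fun t => (σ t).trans (Equiv.addRight c)).trans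
        (snocEquiv k m))
  have hY : ∀ c a t, Y c (a ::ᵥ t) = t.snoc (σ t a + c) := by
    intro c a t
    have : (consEquiv k m).symm (a ::ᵥ t) = (t, a) := by
      rw [Equiv.symm_apply_eq]; rfl
    change snocEquiv k m (Equiv.prodShear _ _ ((consEquiv k m).symm (a ::ᵥ t))) = _
    rw [this]
    rfl
  refine ⟨Y, fun c x => ?_, fun x c c' h => ?_, fun i => ?_⟩
  · obtain ⟨a, t, rfl⟩ := List.Vector.exists_eq_cons x
    exact adj_cons_iff.2 ⟨_, hY c a t⟩
  · obtain ⟨a, t, rfl⟩ := List.Vector.exists_eq_cons x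
    simp only [hY] at h
    exact add_left_cancel (snoc_injective2 h).2
  · obtain ⟨a, t, h⟩ := List.Vector.exists_eq_cons (v i)
    rw [h, hY, add_zero]
    exact hσ t i a h

/-- A cycle of length `r` yields spanning closed trails with `q * k ^ n + r` edges. -/
theorem exists_isClosedTrail_of_cycle {q r : ℕ} (hq : 0 < q) (hqk : q < k) (hr : 0 < r)
    {v : ZMod r → List.Vector (Fin k) (m + 1)}
    (hv : Function.Injective v) (hadj : ∀ i, (deBruijnGraph k (m + 1)).Adj (v i) (v (i + 1))) :
    ∃ u : ZMod (q * k ^ (m + 1) + r) → List.Vector (Fin k) (m + 1),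
      (deBruijnGraph k (m + 1)).IsClosedTrail u ∧ Function.Surjective u := by
  have : NeZero k := ⟨by omega⟩
  have : NeZero r := ⟨hr.ne'⟩
  obtain ⟨Y, hY, hYinj, hYv⟩ := exists_perm_family hv hadj
  -- The shift by one skips `Y 0`, whose edges include the cycle.
  let γ : Fin q → Fin k := fun c => ⟨c + 1, by omega⟩
  have hγ0 : ∀ c, γ c ≠ 0 := fun c h => by simpa [γ] using congrArg Fin.val h
  have hγ : Function.Injective γ := fun c c' h => by
    have := congrArg Fin.val h
    exact Fin.ext (by simpa [γ] using this)
  -- `J` indexes the chosen edges, `s` gives their tails, and `τ` sends each to the next edge of its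
  -- trail.
  let J := ZMod r ⊕ Fin q × List.Vector (Fin k) (m + 1)
  let s : J → List.Vector (Fin k) (m + 1) := Sum.elim v Prod.snd
  let τ : Equiv.Perm J := Equiv.sumCongr (Equiv.addRight 1)
    (Equiv.prodShear (Equiv.refl _) fun c => Y (γ c))
  have hJ : Nat.card J = q * k ^ (m + 1) + r := by
    simp [J, Nat.card_eq_fintype_card, ZMod.card, add_comm]
  rw [← hJ]
  have hs : Function.Surjective s := fun x => ⟨Sum.inr (⟨0, hq⟩, x), rfl⟩
  refine Digraph.exists_isClosedTrail_surjective adj_of_adj_of_adj_of_adj reflTransGen_adj hs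
    (τ₀ := τ) ?_ ?_
  · rintro (i | ⟨c, x⟩)
    · exact hadj i
    · exact hY _ _
  · have hne : ∀ i c x, (v i, v (i + 1)) ≠ (x, Y (γ c) x) := by
      intro i c x h
      obtain ⟨rfl, h⟩ := Prod.mk.inj h
      rw [← hYv i] at h
      exact hγ0 c (hYinj _ h).symm
    rintro (i | ⟨c, x⟩) (j | ⟨d, y⟩) h
    · exact congrArg Sum.inl (hv (Prod.mk.inj h).1)
    · exact absurd h (hne i d y)
    · exact absurd h.symm (hne j c x)
    · obtain ⟨h₁, h₂⟩ := Prod.mk.inj h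
      change x = y at h₁
      subst h₁
      exact congrArg (fun c => Sum.inr (c, x)) (hγ (hYinj x h₂))

/-- A closed trail yields a cycle in the de Bruijn graph of the next order. -/
theorem exists_cycle_of_isClosedTrail {N : ℕ} {u : ZMod N → List.Vector (Fin k) (m + 1)}
    (hu : (deBruijnGraph k (m + 1)).IsClosedTrail u) :
    ∃ v : ZMod N → List.Vector (Fin k) (m + 2), Function.Injective v ∧
      ∀ i, (deBruijnGraph k (m + 2)).Adj (v i) (v (i + 1)) := by
  -- The edge from `a t` to `t b` is encoded as the word `a t b`.
  refine ⟨fun i => (u i).head ::ᵥ u (i + 1), fun i j h => ?_, fun i => ?_⟩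
  · obtain ⟨h₁, h₂⟩ := cons_injective2 h
    refine hu.inj (Prod.ext ?_ h₂)
    obtain ⟨a, b, t, e, e'⟩ := adj_iff.1 (hu.adj i)
    obtain ⟨a', b', t', f, f'⟩ := adj_iff.1 (hu.adj j)
    change u i = u j
    rw [e', f'] at h₂
    rw [e, f, List.Vector.head_cons, List.Vector.head_cons] at h₁
    rw [e, f, h₁, (snoc_injective2 h₂).1]
  · obtain ⟨a, b, t, e, e'⟩ := adj_iff.1 (hu.adj (i + 1))
    refine adj_cons_iff.2 ⟨b, ?_⟩
    change (u (i + 1)).head ::ᵥ u (i + 1 + 1) = (u (i + 1)).snoc b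
    rw [e', e]
    rfl

theorem exists_eq_mul_add {B N : ℕ} (hN : B < N) (hN' : N ≤ k * B) :
    ∃ q r, 0 < q ∧ q < k ∧ 0 < r ∧ r ≤ B ∧ N = q * B + r := by
  have hB : 0 < B := Nat.pos_of_ne_zero (by rintro rfl; simp at hN'; omega)
  -- Dividing `N - 1` puts the remainder in `1, …, B`, since a cycle needs positive length.
  refine ⟨(N - 1) / B, (N - 1) % B + 1, Nat.div_pos (by omega) hB, ?_, by omega,
    Nat.mod_lt _ hB, ?_⟩
  · rw [Nat.div_lt_iff_lt_mul hB]; omega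
  · have := Nat.div_add_mod' (N - 1) B
    omega

/-- The de Bruijn graph has cycles of all lengths. -/
theorem exists_cycle (m N : ℕ) (hN : 0 < N) (hN' : N ≤ k ^ (m + 1)) :
    ∃ v : ZMod N → List.Vector (Fin k) (m + 1), Function.Injective v ∧
      ∀ i, (deBruijnGraph k (m + 1)).Adj (v i) (v (i + 1)) := by
  have : NeZero N := ⟨hN.ne'⟩
  induction m generalizing N with
  | zero =>
    -- In order one every two letters are adjacent, so any `N` distinct letters form a cycle.
    refine ⟨fun i => ⟨i.val, (ZMod.val_lt i).trans_le (by simpa using hN')⟩ ::ᵥ List.Vector.nil,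
      fun i j h => ?_, fun i => adj_cons_iff.2 ⟨_, rfl⟩⟩
    exact ZMod.val_injective N (by simpa using congrArg Fin.val (cons_injective2 h).1)
  | succ m ih =>
    rcases le_or_gt N (k ^ (m + 1)) with h | h
    · obtain ⟨v, hv, hadj⟩ := ih N hN h this
      exact exists_cycle_of_isClosedTrail ⟨hadj, fun i j hij => hv (Prod.mk.inj hij).1⟩
    · obtain ⟨q, r, hq, hqk, hr, hr', rfl⟩ := exists_eq_mul_add h (by rwa [← pow_succ'])
      obtain ⟨v, hv, hadj⟩ := ih r hr hr' ⟨hr.ne'⟩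
      obtain ⟨u, hu, -⟩ := exists_isClosedTrail_of_cycle hq hqk hr hv hadj
      exact exists_cycle_of_isClosedTrail hu

end deBruijnGraph

/-! ### The subgraph of a closed trail. -/

namespace Digraph.IsClosedTrail

variable {V : Type*} {G : Digraph V} {N : ℕ} {u : ZMod N → V}

/-- The subgraph formed by the vertices and edges of a closed trail. -/
def toDiSubgraph (hu : G.IsClosedTrail u) : G.DiSubgraph where
  verts := Set.range u
  Adj x y := ∃ i, u i = x ∧ u (i + 1) = y
  adj_sub := by rintro _ _ ⟨i, rfl, rfl⟩; exact hu.adj i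
  fst_mem := by rintro _ _ ⟨i, rfl, rfl⟩; exact ⟨i, rfl⟩
  snd_mem := by rintro _ _ ⟨i, rfl, rfl⟩; exact ⟨i + 1, rfl⟩

theorem isConnected_toDiSubgraph [NeZero N] (hu : G.IsClosedTrail u) :
    hu.toDiSubgraph.IsConnected := by
  refine ⟨⟨u 0, 0, rfl⟩, ?_⟩
  rintro _ ⟨i, rfl⟩ _ ⟨j, rfl⟩
  have key : ∀ n : ℕ, Relation.ReflTransGen
      (fun x y => hu.toDiSubgraph.Adj x y ∨ hu.toDiSubgraph.Adj y x) (u i) (u (i + n)) := by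
    intro n
    induction n with
    | zero => simpa using Relation.ReflTransGen.refl
    | succ n ih => exact ih.tail (Or.inl ⟨i + n, rfl, by push_cast; rw [add_assoc]⟩)
  simpa using key (j - i).val

/-- As no edge repeats, both degrees count the visits of the trail to the vertex. -/
theorem isEulerian_toDiSubgraph (hu : G.IsClosedTrail u) : hu.toDiSubgraph.IsEulerian := by
  intro x _
  have hin : {y | hu.toDiSubgraph.Adj y x} = u '' {i | u (i + 1) = x} := by
    ext y
    exact ⟨fun ⟨i, h₁, h₂⟩ => ⟨i, h₂, h₁⟩, fun ⟨i, h₂, h₁⟩ => ⟨i, h₁, h₂⟩⟩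
  have hout : {y | hu.toDiSubgraph.Adj x y} = (fun i => u (i + 1)) '' {i | u i = x} := by
    ext y
    exact ⟨fun ⟨i, h₁, h₂⟩ => ⟨i, h₁, h₂⟩, fun ⟨i, h₁, h₂⟩ => ⟨i, h₁, h₂⟩⟩
  have hinj₁ : Set.InjOn u {i | u (i + 1) = x} := fun i hi j hj h =>
    hu.inj (Prod.ext h (hi.trans hj.symm))
  have hinj₂ : Set.InjOn (fun i => u (i + 1)) {i | u i = x} := fun i hi j hj h =>
    hu.inj (Prod.ext (hi.trans hj.symm) h)
  have hshift : {i | u i = x} = (fun i => i + 1) '' {i | u (i + 1) = x} := by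
    ext i
    exact ⟨fun h => ⟨i - 1, by simpa using h, by simp⟩, by rintro ⟨j, hj, rfl⟩; exact hj⟩
  rw [hin, hout, hinj₁.encard_image, hinj₂.encard_image, hshift,
    (add_left_injective (1 : ZMod N)).encard_image]

theorem encard_univ_zmod [NeZero N] : (Set.univ : Set (ZMod N)).encard = N := by
  rw [Set.encard_univ, ENat.card_eq_coe_fintype_card, ZMod.card]

theorem encard_edges_toDiSubgraph [NeZero N] (hu : G.IsClosedTrail u) :
    hu.toDiSubgraph.edges.encard = N := by
  have h : hu.toDiSubgraph.edges = (fun i => (u i, u (i + 1))) '' Set.univ := by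
    ext ⟨x, y⟩
    simp [DiSubgraph.edges, toDiSubgraph]
  rw [h, hu.inj.encard_image, encard_univ_zmod]

end Digraph.IsClosedTrail

theorem mainTheorem4 (k n : ℕ) (hk : 2 ≤ k) (hn : 1 ≤ n) (N : ℕ) (hN : 0 < N)
    (hN' : N ≤ k ^ (n + 1)) :
    ∃ H : (deBruijnGraph k n).DiSubgraph,
      H.IsConnected ∧ H.IsEulerian ∧
      H.edges.encard = (N : ℕ∞) ∧ H.verts.encard = ((min (k ^ n) N : ℕ) : ℕ∞) ∧
      (N ≤ k ^ n → H.IsCycle) ∧ (k ^ n < N → H.verts = Set.univ) := by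
  obtain ⟨m, rfl⟩ := Nat.exists_eq_add_of_le' hn
  have : NeZero N := ⟨hN.ne'⟩
  rcases le_or_gt N (k ^ (m + 1)) with h | h
  · obtain ⟨v, hv, hadj⟩ := deBruijnGraph.exists_cycle m N hN h
    have hu : (deBruijnGraph k (m + 1)).IsClosedTrail v :=
      ⟨hadj, fun i j hij => hv (Prod.mk.inj hij).1⟩
    refine ⟨hu.toDiSubgraph, hu.isConnected_toDiSubgraph, hu.isEulerian_toDiSubgraph,
      hu.encard_edges_toDiSubgraph, ?_, fun _ => ⟨N, hN, v, hv, rfl, fun _ _ => Iff.rfl⟩,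
      fun h' => absurd h' h.not_gt⟩
    rw [min_eq_right h, ← Digraph.IsClosedTrail.encard_univ_zmod, ← hv.encard_image, Set.image_univ]
    rfl
  · obtain ⟨q, r, hq, hqk, hr, hr', rfl⟩ :=
      deBruijnGraph.exists_eq_mul_add h (by rwa [← pow_succ'])
    obtain ⟨v, hv, hadj⟩ := deBruijnGraph.exists_cycle m r hr hr'
    obtain ⟨u, hu, hsurj⟩ := deBruijnGraph.exists_isClosedTrail_of_cycle hq hqk hr hv hadj
    have huniv : hu.toDiSubgraph.verts = Set.univ := hsurj.range_eq
    refine ⟨hu.toDiSubgraph, hu.isConnected_toDiSubgraph, hu.isEulerian_toDiSubgraph,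
      hu.encard_edges_toDiSubgraph, ?_, fun h' => absurd h' h.not_ge, fun _ => huniv⟩
    rw [min_eq_left h.le, huniv, Set.encard_univ, ENat.card_eq_coe_fintype_card, card_vector,
      Fintype.card_fin]
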